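/- Let $\mathcal A$ be a category with finite products, let $F\colon\mathcal A\to\mathcal A$ be an endofunctor, and let $(A,\alpha\colon A\to FA)$ be an $F$-coalgebra. For subobjects $s\colon S\rightarrowtail A$ and $t\colon T\rightarrowtail A$, say that $t$ is the *next time* of $s$, written $t=\bigcirc s$, if $t$ is the inverse image of $Fs$ along $\alpha$, i.e. if there is a morphism $p\colon T\to FS$ for which the square $$Fs\cdot p=\alpha\cdot t$$ is a pullback. (Such a $t$ is unique if it exists, and it exists for every $s$ if $\mathcal A$ has pullbacks and $F$ preserves monomorphisms.) The coalgebra $(A,\alpha)$ is *well-founded* if $\mathrm{id}_A$ is the only subobject $s$ of $A$ with $\bigcirc s=s$. It is *parametrically recursive* if for every object $X$ and every morphism $e\colon FX\times A\to X$ there is a unique morphism $e^\dagger\colon A\to X$ with $$e^\dagger=e\cdot(Fe^\dagger\times \mathrm{id}_A)\cdot\langle\alpha,\mathrm{id}_A\rangle .$$ **Corollary.** For every endofunctor $F$ on $\mathsf{Set}$, and for every field $K$ and every endofunctor $F$ on the category $\mathsf{Vec}_K$ of $K$-vector spaces and linear maps, every well-founded $F$-coalgebra is parametrically recursive. (No preservation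 property of $F$ is assumed.) -/

import Mathlib

open CategoryTheory CategoryTheory.Limits

universe v u w₁ w₂ w₃

/-- The next time operator of a coalgebra `α : A ⟶ F A`, as a relation on the subobjects of `A`:
`t` is the next time `○ s` of `s` if `t` is the inverse image of `F s` along `α`, that is,
if there is a pullback square
```
  T ----> F S
  |        |
t |        | F s
  v        v
  A ----> F A
      α
```
The relation is functional. It is total as soon as `F` preserves monomorphisms, but it makes sense
for every endofunctor. -/
def IsNextTime {C : Type u} [Category.{v} C] {F : C ⥤ C} (A : Endofunctor.Coalgebra F)
    (s t : Subobject A.V) : Prop :=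
  ∃ p : (t : C) ⟶ F.obj (s : C), IsPullback p t.arrow (F.map s.arrow) A.str

/-- A coalgebra is well-founded if the identity (the largest subobject) is the only fixed point of
its next time operator. -/
def IsWellFoundedCoalgebra {C : Type u} [Category.{v} C] {F : C ⥤ C}
    (A : Endofunctor.Coalgebra F) : Prop :=
  ∀ s : Subobject A.V, IsNextTime A s s ↔ s = ⊤

/-- A coalgebra `α : A ⟶ F A` is parametrically recursive if for every `e : F X × A ⟶ X` there is a
unique `h : A ⟶ X` with `h = e ∘ (F h × A) ∘ ⟨α, A⟩`. -/
def IsParametricallyRecursive {C : Type u} [Category.{v} C] [HasBinaryProducts C] {F : C ⥤ C}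
    (A : Endofunctor.Coalgebra F) : Prop :=
  ∀ (X : C) (e : F.obj X ⨯ A.V ⟶ X),
    ∃! h : A.V ⟶ X, h = prod.lift A.str (𝟙 A.V) ≫ prod.map (F.map h) (𝟙 A.V) ≫ e

/-! Existence: partial solutions on subcoalgebras glue along chains, so Zorn gives a maximal one.
One recursion step extends it to the next time of its domain, so this domain is a fixed point, hence
all of `A` by well-foundedness. Uniqueness: two solutions agree on the least fixed point of next
time, again all of `A`. Both arguments need only the lattice axioms of `UnionSystem` and
`NextTimeOperator`. Monomorphisms split in vector spaces, and in sets when the domain is nonempty,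
so `F` preserves these; the empty subset is handled separately. -/

/-- A complete lattice `L` of monomorphisms into `A` in which suprema behave like unions: maps out
of a supremum are determined by their restrictions, and can be glued along chains. -/
structure UnionSystem {C : Type u} [Category.{v} C] (A : C) (L : Type v) [CompleteLattice L] where
  obj : L ⥤ C
  arr (l : L) : obj.obj l ⟶ A
  mono_arr (l : L) : Mono (arr l)
  map_arr {l m : L} (h : l ≤ m) : obj.map (homOfLE h) ≫ arr m = arr l
  hom_ext (S : Set L) {Y : C} (f g : obj.obj (sSup S) ⟶ Y)
    (h : ∀ l (hl : l ∈ S), obj.map (homOfLE (le_sSup hl)) ≫ f =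
      obj.map (homOfLE (le_sSup hl)) ≫ g) : f = g
  glue {I : Type v} (l : I → L) {Y : C} (f : ∀ i, obj.obj (l i) ⟶ Y)
    (h : ∀ i j, (∃ hij : l i ≤ l j, obj.map (homOfLE hij) ≫ f j = f i) ∨
      ∃ hji : l j ≤ l i, obj.map (homOfLE hji) ≫ f i = f j) :
    ∃ g : obj.obj (iSup l) ⟶ Y, ∀ i, obj.map (homOfLE (le_iSup l i)) ≫ g = f i

namespace UnionSystem

variable {C : Type u} [Category.{v} C] {A : C} {L : Type v} [CompleteLattice L]

lemma map_arr_assoc (U : UnionSystem A L) {l m : L} (h : l ≤ m) {Y : C} (f : A ⟶ Y) :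
    U.obj.map (homOfLE h) ≫ U.arr m ≫ f = U.arr l ≫ f := by
  rw [← U.map_arr h, Category.assoc]

lemma hom_ext_iSup (U : UnionSystem A L) {I : Type v} (l : I → L) {Y : C}
    (f g : U.obj.obj (iSup l) ⟶ Y)
    (h : ∀ i, U.obj.map (homOfLE (le_iSup l i)) ≫ f = U.obj.map (homOfLE (le_iSup l i)) ≫ g) :
    f = g := by
  apply U.hom_ext (Set.range l)
  rintro _ ⟨i, rfl⟩
  exact h i

end UnionSystem

/-- Well-foundedness concerns chosen representatives of subobjects; the square is transported to
them. -/
lemma IsWellFoundedCoalgebra.isIso_of_isPullback {C : Type u} [Category.{v} C] {F : C ⥤ C}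
    {A : Endofunctor.Coalgebra F} (hA : IsWellFoundedCoalgebra A) {S : C} (s : S ⟶ A.V) [Mono s]
    (p : S ⟶ F.obj S) (h : IsPullback p s (F.map s) A.str) : IsIso s := by
  rw [Subobject.isIso_iff_mk_eq_top, ← hA]
  refine ⟨(Subobject.underlyingIso s).hom ≫ p ≫ F.map (Subobject.underlyingIso s).inv, ?_⟩
  refine h.of_iso (Subobject.underlyingIso s).symm (F.mapIso (Subobject.underlyingIso s).symm)
    (Iso.refl _) (Iso.refl _) ?_ ?_ ?_ ?_
  · simp
  · simp
  · simp [← F.map_comp]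
  · simp

/-- A monotone operator on a system of subobjects of a coalgebra that acts as the next time
operator. -/
structure NextTimeOperator {C : Type u} [Category.{v} C] {F : C ⥤ C}
    (A : Endofunctor.Coalgebra F) {L : Type v} [CompleteLattice L] (U : UnionSystem A.V L) where
  next : L →o L
  exists_lift (l : L) : ∃ p : U.obj.obj (next l) ⟶ F.obj (U.obj.obj l),
    p ≫ F.map (U.arr l) = U.arr (next l) ≫ A.str
  exists_extend (l : L) (σ : U.obj.obj l ⟶ F.obj (U.obj.obj l))
    (hσ : σ ≫ F.map (U.arr l) = U.arr l ≫ A.str) :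
    ∃ (h : l ≤ next l) (p : U.obj.obj (next l) ⟶ F.obj (U.obj.obj l)),
      p ≫ F.map (U.arr l) = U.arr (next l) ≫ A.str ∧ U.obj.map (homOfLE h) ≫ p = σ
  isIso_of_fixed (l : L) : next l = l → IsIso (U.arr l)

/-! ### Recursion from an abstract next time operator -/

section Recursion

variable {C : Type u} [Category.{v} C] [HasBinaryProducts C] {F : C ⥤ C}
  {A : Endofunctor.Coalgebra F} {L : Type v} [CompleteLattice L] {U : UnionSystem A.V L}

/-- A solution of the recursive equation given by `e` on a subcoalgebra of `A`. -/
structure PartialSolution (U : UnionSystem A.V L) {X : C} (e : F.obj X ⨯ A.V ⟶ X) where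
  dom : L
  str : U.obj.obj dom ⟶ F.obj (U.obj.obj dom)
  str_arr : str ≫ F.map (U.arr dom) = U.arr dom ≫ A.str
  sol : U.obj.obj dom ⟶ X
  sol_eq : sol = prod.lift (str ≫ F.map sol) (U.arr dom) ≫ e

namespace PartialSolution

variable {X : C} {e : F.obj X ⨯ A.V ⟶ X}

/-- Structures are compared too: `F.map (U.arr _)` need not be monic, so the domain need not
determine them. -/
instance : Preorder (PartialSolution U e) where
  le P Q := ∃ h : P.dom ≤ Q.dom,
    U.obj.map (homOfLE h) ≫ Q.str = P.str ≫ F.map (U.obj.map (homOfLE h)) ∧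
    U.obj.map (homOfLE h) ≫ Q.sol = P.sol
  le_refl P := ⟨le_rfl, by simp, by simp⟩
  le_trans P Q R := by
    rintro ⟨h₁, a₁, b₁⟩ ⟨h₂, a₂, b₂⟩
    refine ⟨h₁.trans h₂, ?_, ?_⟩
    · rw [← homOfLE_comp h₁ h₂, U.obj.map_comp, Category.assoc, a₂, F.map_comp, reassoc_of% a₁]
    · rw [← homOfLE_comp h₁ h₂, U.obj.map_comp, Category.assoc, b₂, b₁]

lemma bddAbove_of_isChain (c : Set (PartialSolution U e)) (hc : IsChain (· ≤ ·) c) :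
    BddAbove c := by
  have tot (P Q : c) : P.1 ≤ Q.1 ∨ Q.1 ≤ P.1 := hc.total P.2 Q.2
  obtain ⟨σ, hσ⟩ := U.glue (fun P : c ↦ P.1.dom)
    (fun P ↦ P.1.str ≫ F.map (U.obj.map (homOfLE (le_iSup (fun P : c ↦ P.1.dom) P)))) (by
      intro P Q
      refine (tot P Q).imp ?_ ?_
      all_goals
        rintro ⟨h, a, -⟩
        refine ⟨h, ?_⟩
        rw [reassoc_of% a, ← F.map_comp, ← U.obj.map_comp, homOfLE_comp])
  obtain ⟨g, hg⟩ := U.glue (fun P : c ↦ P.1.dom) (fun P ↦ P.1.sol) (by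
      intro P Q
      refine (tot P Q).imp ?_ ?_
      all_goals
        rintro ⟨h, -, b⟩
        exact ⟨h, b⟩)
  refine ⟨⟨iSup (fun P : c ↦ P.1.dom), σ, ?_, g, ?_⟩, ?_⟩
  · apply U.hom_ext_iSup
    intro P
    rw [reassoc_of% hσ P, ← F.map_comp, U.map_arr, U.map_arr_assoc, P.1.str_arr]
  · apply U.hom_ext_iSup
    intro P
    rw [hg P, P.1.sol_eq, prod.comp_lift_assoc, reassoc_of% hσ P, ← F.map_comp, hg P, U.map_arr,
      ← P.1.sol_eq]
  · intro P hP
    exact ⟨le_iSup (fun P : c ↦ P.1.dom) ⟨P, hP⟩, hσ ⟨P, hP⟩, hg ⟨P, hP⟩⟩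

lemma exists_isIso_arr (N : NextTimeOperator A U) : ∃ P : PartialSolution U e,
    IsIso (U.arr P.dom) := by
  obtain ⟨P, hP⟩ := zorn_le (bddAbove_of_isChain (U := U) (e := e))
  refine ⟨P, N.isIso_of_fixed _ ?_⟩
  obtain ⟨h, p, hp, hσ⟩ := N.exists_extend P.dom P.str P.str_arr
  have hsol : U.obj.map (homOfLE h) ≫ prod.lift (p ≫ F.map P.sol) (U.arr (N.next P.dom)) ≫ e =
      P.sol := by
    rw [prod.comp_lift_assoc, reassoc_of% hσ, U.map_arr, ← P.sol_eq]
  let Q : PartialSolution U e :=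
    { dom := N.next P.dom
      str := p ≫ F.map (U.obj.map (homOfLE h))
      str_arr := by rw [Category.assoc, ← F.map_comp, U.map_arr, hp]
      -- The equation itself dictates the values on the larger domain.
      sol := prod.lift (p ≫ F.map P.sol) (U.arr (N.next P.dom)) ≫ e
      sol_eq := by rw [Category.assoc, ← F.map_comp, hsol] }
  have hPQ : P ≤ Q := ⟨h, by simp only [Q, reassoc_of% hσ], hsol⟩
  exact le_antisymm (hP hPQ).1 h

end PartialSolution

theorem NextTimeOperator.isParametricallyRecursive (N : NextTimeOperator A U) :
    IsParametricallyRecursive A := by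
  intro X e
  simp only [prod.lift_map_assoc, Category.comp_id]
  obtain ⟨P, hP⟩ := PartialSolution.exists_isIso_arr (e := e) N
  have hsol : inv (U.arr P.dom) ≫ P.sol =
      prod.lift (A.str ≫ F.map (inv (U.arr P.dom) ≫ P.sol)) (𝟙 A.V) ≫ e := by
    rw [← cancel_epi (U.arr P.dom), IsIso.hom_inv_id_assoc, prod.comp_lift_assoc,
      Category.comp_id, ← Category.assoc (U.arr P.dom), ← P.str_arr, Category.assoc,
      ← F.map_comp, IsIso.hom_inv_id_assoc, ← P.sol_eq]
  refine ⟨inv (U.arr P.dom) ≫ P.sol, ?_, ?_⟩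
  · exact hsol
  · suffices H : ∀ h₁ h₂ : A.V ⟶ X, h₁ = prod.lift (A.str ≫ F.map h₁) (𝟙 A.V) ≫ e →
        h₂ = prod.lift (A.str ≫ F.map h₂) (𝟙 A.V) ≫ e → h₁ = h₂ by
      exact fun h hh ↦ H h _ hh hsol
    intro h₁ h₂ e₁ e₂
    have key : U.arr N.next.lfp ≫ h₁ = U.arr N.next.lfp ≫ h₂ := by
      -- Agreement passes from `l` to `next l` because `A.str` restricted to `next l` factors
      -- through `F.map (U.arr l)`.
      refine N.next.lfp_induction (p := fun l ↦ U.arr l ≫ h₁ = U.arr l ≫ h₂) ?_ ?_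
      · intro l hl _
        obtain ⟨p, hp⟩ := N.exists_lift l
        rw [e₁, e₂, prod.comp_lift_assoc, prod.comp_lift_assoc, ← reassoc_of% hp,
          ← reassoc_of% hp, ← F.map_comp, ← F.map_comp, hl]
      · intro S hS
        apply U.hom_ext
        intro l hl
        rw [U.map_arr_assoc, U.map_arr_assoc, hS l hl]
    have := N.isIso_of_fixed _ N.next.map_lfp
    exact (cancel_epi _).1 key

end Recursion

/-! ### Sets -/

/-- Subsets as a system of subobjects in the category of types. -/
def setUnionSystem (A : Type v) : UnionSystem A (Set A) where
  obj :=
    { obj := fun S ↦ S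
      map := fun f ↦ TypeCat.ofHom (Set.inclusion f.le) }
  arr S := TypeCat.ofHom Subtype.val
  mono_arr S := (CategoryTheory.ofHom_mono_iff_injective _).2 Subtype.val_injective
  map_arr _ := rfl
  hom_ext 𝒮 Y f g h := by
    ext ⟨x, S, hS, hx⟩
    exact ConcreteCategory.congr_hom (h S hS) ⟨x, hx⟩
  glue {I} l {Y} f h := by
    have hf (i j) (x : A) (hi : x ∈ l i) (hj : x ∈ l j) : f i ⟨x, hi⟩ = f j ⟨x, hj⟩ := by
      rcases h i j with ⟨_, h⟩ | ⟨_, h⟩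
      · exact (ConcreteCategory.congr_hom h ⟨x, hi⟩).symm
      · exact ConcreteCategory.congr_hom h ⟨x, hj⟩
    refine ⟨TypeCat.ofHom (Set.iUnionLift l (fun i x ↦ f i x) hf (⋃ i, l i) subset_rfl),
      fun i ↦ ?_⟩
    ext x
    exact Set.iUnionLift_inclusion (f := fun i x ↦ f i x) (hf := hf) (hT := subset_rfl) x
      (Set.subset_iUnion l i)

lemma Types.map_injective_of_nonempty (F : Type v ⥤ Type v) {S T : Type v} [Nonempty S]
    (f : S ⟶ T) (hf : Function.Injective f) : Function.Injective (F.map f) := by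
  have hr : f ≫ TypeCat.ofHom (Function.invFun f) = 𝟙 _ := by
    ext z
    exact Function.leftInverse_invFun hf z
  refine Function.LeftInverse.injective (g := F.map (TypeCat.ofHom (Function.invFun f)))
    fun z ↦ ?_
  have := congrArg F.map hr
  rw [F.map_comp, F.map_id] at this
  exact ConcreteCategory.congr_hom this z

/-- The next time operator on subsets. It is the preimage of the image of `F s`, also in the case
where `F s` is not injective. -/
def setNextTimeOperator {F : Type v ⥤ Type v} {A : Endofunctor.Coalgebra F}
    (hA : IsWellFoundedCoalgebra A) : NextTimeOperator A (setUnionSystem A.V) where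
  next :=
    { toFun := fun S ↦ A.str ⁻¹' Set.range (F.map ((setUnionSystem A.V).arr S))
      monotone' := by
        rintro S T h x ⟨y, hy⟩
        refine ⟨F.map ((setUnionSystem A.V).obj.map (homOfLE h)) y, ?_⟩
        rw [← hy, ← (setUnionSystem A.V).map_arr h, F.map_comp]
        rfl }
  exists_lift S := by
    refine ⟨TypeCat.ofHom fun x ↦ x.2.choose, ?_⟩
    ext x
    exact x.2.choose_spec
  exists_extend S σ hσ := by
    classical
    refine ⟨fun x hx ↦ ⟨σ ⟨x, hx⟩, ConcreteCategory.congr_hom hσ ⟨x, hx⟩⟩,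
      -- Using `σ` on `S` makes the lift extend it without injectivity of `F.map`, which may fail
      -- for empty `S`.
      TypeCat.ofHom fun x ↦ if hx : x.1 ∈ S then σ ⟨x.1, hx⟩ else x.2.choose, ?_, ?_⟩
    · ext x
      by_cases hx : x.1 ∈ S
      · refine Eq.trans ?_ (ConcreteCategory.congr_hom hσ ⟨x.1, hx⟩)
        exact congrArg (F.map ((setUnionSystem A.V).arr S)) (dif_pos hx)
      · refine Eq.trans ?_ x.2.choose_spec
        exact congrArg (F.map ((setUnionSystem A.V).arr S)) (dif_neg hx)
    · ext x
      exact dif_pos x.2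
  isIso_of_fixed S hS := by
    have hmem (x : A.V) : x ∈ S ↔ ∃ y, F.map ((setUnionSystem A.V).arr S) y = A.str x := by
      conv_lhs => rw [← hS]
      rfl
    have := (setUnionSystem A.V).mono_arr S
    refine hA.isIso_of_isPullback _ (TypeCat.ofHom fun x ↦ ((hmem x.1).1 x.2).choose) ?_
    rw [Types.isPullback_iff]
    refine ⟨?_, ?_, ?_⟩
    · ext x
      exact ((hmem x.1).1 x.2).choose_spec
    · rintro x y ⟨-, h⟩
      exact Subtype.ext h
    · intro y x hyx
      -- At a fixed point, any matching pair forces `S` to be nonempty, so injectivity is available;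
      -- for empty `S` there are no pairs.
      have hx : x ∈ S := (hmem x).2 ⟨y, hyx⟩
      refine ⟨⟨x, hx⟩, ?_, rfl⟩
      have hinj : Function.Injective (F.map ((setUnionSystem A.V).arr S)) :=
        have : Nonempty ((setUnionSystem A.V).obj.obj S) := ⟨⟨x, hx⟩⟩
        Types.map_injective_of_nonempty F _ Subtype.val_injective
      exact hinj (((hmem x).1 hx).choose_spec.trans hyx.symm)

/-! ### Vector spaces -/

section Module

variable {K : Type u} [Field K]

/-- Linear subspaces as a system of subobjects in the category of vector spaces. -/
def submoduleUnionSystem (A : ModuleCat.{v} K) : UnionSystem A (Submodule K A) where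
  obj :=
    { obj := fun S ↦ ModuleCat.of K S
      map := fun f ↦ ModuleCat.ofHom (Submodule.inclusion f.le) }
  arr S := ModuleCat.ofHom S.subtype
  mono_arr S := (ModuleCat.mono_iff_injective _).2 Subtype.val_injective
  map_arr _ := rfl
  hom_ext 𝒮 Y f g h := by
    -- The equalizer of `f` and `g` is a subspace containing every member of `𝒮`, hence their
    -- supremum.
    have hle : sSup 𝒮 ≤ (LinearMap.eqLocus f.hom g.hom).map (sSup 𝒮).subtype := by
      refine sSup_le fun S hS x hx ↦ ⟨⟨x, le_sSup hS hx⟩, ?_, rfl⟩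
      exact ConcreteCategory.congr_hom (h S hS) ⟨x, hx⟩
    ext x
    obtain ⟨y, hy, hyx⟩ := hle x.2
    obtain rfl : y = x := Subtype.ext hyx
    exact hy
  glue {I} l {Y} f h := by
    let P (i : I) : A →ₗ.[K] Y := ⟨l i, (f i).hom⟩
    have hP : DirectedOn (· ≤ ·) (Set.range P) := by
      refine IsChain.directedOn ?_
      rintro _ ⟨i, rfl⟩ _ ⟨j, rfl⟩ -
      refine (h i j).imp ?_ ?_
      all_goals
        rintro ⟨hle, h⟩
        refine ⟨hle, fun x y hxy ↦ ?_⟩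
        refine (ConcreteCategory.congr_hom h x).symm.trans ?_
        exact congrArg (ConcreteCategory.hom (f _)) (Subtype.ext hxy)
    have hle : iSup l ≤ (LinearPMap.sSup _ hP).domain :=
      iSup_le fun i ↦ (LinearPMap.le_sSup hP ⟨i, rfl⟩).1
    refine ⟨ModuleCat.ofHom ((LinearPMap.sSup _ hP).toFun ∘ₗ Submodule.inclusion hle), ?_⟩
    intro i
    ext x
    exact ((LinearPMap.le_sSup hP ⟨i, rfl⟩).2 (x := x) rfl).symm

variable {F : ModuleCat.{v} K ⥤ ModuleCat.{v} K}

/-- Over a field an injection has a linear retraction, which `F` preserves. -/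
lemma ModuleCat.map_injective_of_field {S T : ModuleCat.{v} K} (f : S ⟶ T)
    (hf : Function.Injective f) : Function.Injective (F.map f) := by
  obtain ⟨r, hr⟩ := f.hom.exists_leftInverse_of_injective (LinearMap.ker_eq_bot.2 hf)
  have hr' : f ≫ ModuleCat.ofHom r = 𝟙 _ := ModuleCat.hom_ext hr
  refine Function.LeftInverse.injective (g := F.map (ModuleCat.ofHom r)) fun z ↦ ?_
  have := congrArg F.map hr'
  rw [F.map_comp, F.map_id] at this
  exact ConcreteCategory.congr_hom this z

lemma ModuleCat.exists_comp_eq_of_range_le {S T Y : ModuleCat.{v} K} (f : S ⟶ Y) (g : T ⟶ Y)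
    (hg : Function.Injective g) (h : ∀ x, f x ∈ LinearMap.range g.hom) :
    ∃ p : S ⟶ T, p ≫ g = f := by
  refine ⟨ModuleCat.ofHom ((LinearEquiv.ofInjective g.hom hg).symm.toLinearMap ∘ₗ
    f.hom.codRestrict _ h), ?_⟩
  ext x
  exact congrArg Subtype.val
    ((LinearEquiv.ofInjective g.hom hg).apply_symm_apply (f.hom.codRestrict _ h x))

/-- The next time operator on linear subspaces. -/
def submoduleNextTimeOperator {A : Endofunctor.Coalgebra F} (hA : IsWellFoundedCoalgebra A) :
    NextTimeOperator A (submoduleUnionSystem A.V) := by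
  let U := submoduleUnionSystem A.V
  have hinj (S) : Function.Injective (F.map (U.arr S)) :=
    ModuleCat.map_injective_of_field _ Subtype.val_injective
  have hmono (S) : Mono (F.map (U.arr S)) := (ModuleCat.mono_iff_injective _).2 (hinj S)
  have := U.mono_arr
  refine
    { next :=
        { toFun := fun S ↦ (LinearMap.range (F.map (U.arr S)).hom).comap A.str.hom
          monotone' := ?_ }
      exists_lift := ?_
      exists_extend := ?_
      isIso_of_fixed := ?_ }
  · rintro S T h x ⟨y, hy⟩
    refine ⟨F.map (U.obj.map (homOfLE h)) y, hy ▸ ?_⟩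
    rw [← U.map_arr h, F.map_comp]
    rfl
  · exact fun S ↦ ModuleCat.exists_comp_eq_of_range_le _ _ (hinj S) fun x ↦ x.2
  · intro S σ hσ
    obtain ⟨p, hp⟩ := ModuleCat.exists_comp_eq_of_range_le
      (U.arr ((LinearMap.range (F.map (U.arr S)).hom).comap A.str.hom) ≫ A.str) _ (hinj S)
      fun x ↦ x.2
    have hle : S ≤ (LinearMap.range (F.map (U.arr S)).hom).comap A.str.hom :=
      fun x hx ↦ ⟨σ ⟨x, hx⟩, ConcreteCategory.congr_hom hσ ⟨x, hx⟩⟩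
    refine ⟨hle, p, hp, ?_⟩
    -- Lifts through a monomorphism are unique, so `p` extends `σ` automatically.
    rw [← cancel_mono (F.map (U.arr S)), Category.assoc, hp]
    exact (U.map_arr_assoc hle A.str).trans hσ.symm
  · intro S hS
    have hmem (x : A.V) : x ∈ S ↔ ∃ y, F.map (U.arr S) y = A.str x := by
      conv_lhs => rw [← hS]
      rfl
    obtain ⟨p, hp⟩ := ModuleCat.exists_comp_eq_of_range_le (U.arr S ≫ A.str) _ (hinj S)
      fun x ↦ (hmem x.1).1 x.2
    have hlift (c : PullbackCone (F.map (U.arr S)) A.str) :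
        ∃ φ : c.pt ⟶ U.obj.obj S, φ ≫ U.arr S = c.snd :=
      ⟨ModuleCat.ofHom (c.snd.hom.codRestrict S fun x ↦
        (hmem _).2 ⟨c.fst x, ConcreteCategory.congr_hom c.condition x⟩), rfl⟩
    choose φ hφ using hlift
    refine hA.isIso_of_isPullback (U.arr S) p ⟨⟨hp⟩, ⟨PullbackCone.IsLimit.mk _ φ ?_ hφ ?_⟩⟩
    · intro c
      rw [← cancel_mono (F.map (U.arr S)), Category.assoc, hp, c.condition, reassoc_of% hφ c]
    · intro c m _ hm
      rw [← cancel_mono (U.arr S), hm, hφ]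

end Module

theorem corollaryC :
    (∀ (F : Type w₁ ⥤ Type w₁) (A : Endofunctor.Coalgebra F),
      IsWellFoundedCoalgebra A → IsParametricallyRecursive A) ∧
    (∀ (K : Type w₂) [Field K] (F : ModuleCat.{w₃} K ⥤ ModuleCat.{w₃} K)
      (A : Endofunctor.Coalgebra F),
      IsWellFoundedCoalgebra A → IsParametricallyRecursive A) :=
  ⟨fun _ _ hA ↦ (setNextTimeOperator hA).isParametricallyRecursive,
    fun _ _ _ _ hA ↦ (submoduleNextTimeOperator hA).isParametricallyRecursive⟩
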